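/- Let $\mathbb{B}$ be the open unit ball of the space $\mathbb{C}^{2\times 2}$ of $2\times 2$ complex matrices in the operator norm (induced by the Euclidean norm on $\mathbb{C}^2$), and let \[ \mathcal{P}=\{(a_{21},\operatorname{tr}A,\det A): A=[a_{ij}]_{i,j=1}^2\in\mathbb{B}\}\subset\mathbb{C}^3 \] be the pentablock, with closure $\overline{\mathcal{P}}$ in $\mathbb{C}^3$. For $K\subset\mathbb{C}^n$ let \[ \widehat K=\{z\in\mathbb{C}^n: |f(z)|\le \sup_{K}|f| \text{ for every complex polynomial } f \text{ in } n \text{ variables}\} \] be its polynomial hull. A domain (nonempty connected open set) $\Omega\subset\mathbb{C}^n$ is called polynomially convex if $\widehat K\subset\Omega$ for every compact $K\subset\Omega$; a compact set $K\subset\mathbb{C}^n$ is called polynomially convex if $\widehat K=K$. Theorem. $\mathcal{P}$ is a polynomially convex domain, and $\overline{\mathcal{P}}$ is a polynomially convex compact set. -/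

import Mathlib

/-- The polynomial hull of `K ⊆ ℂⁿ`: the points `z` with `|f z| ≤ sup_K |f|` for every
polynomial `f`. The supremum is expressed by quantifying over all upper bounds `M` of `|f|`
on `K`. -/
def polynomialHull {n : ℕ} (K : Set (Fin n → ℂ)) : Set (Fin n → ℂ) :=
  {z | ∀ (f : MvPolynomial (Fin n) ℂ) (M : ℝ),
    (∀ w ∈ K, ‖MvPolynomial.eval w f‖ ≤ M) → ‖MvPolynomial.eval z f‖ ≤ M}

/-- A domain (nonempty connected open set) `Ω` in `ℂⁿ` is polynomially convex if the polynomial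
hull of each compact subset of `Ω` is contained in `Ω`. -/
structure IsPolynomiallyConvexDomain {n : ℕ} (Ω : Set (Fin n → ℂ)) : Prop where
  isOpen : IsOpen Ω
  isConnected : IsConnected Ω
  hull_subset : ∀ K : Set (Fin n → ℂ), IsCompact K → K ⊆ Ω → polynomialHull K ⊆ Ω

/-- A compact set in `ℂⁿ` is polynomially convex if it equals its polynomial hull. -/
structure IsPolynomiallyConvexCompact {n : ℕ} (K : Set (Fin n → ℂ)) : Prop where
  isCompact : IsCompact K
  hull_eq : polynomialHull K = K

/-- The open unit ball of the `2 × 2` complex matrices in the usual operator norm, that is,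
the norm of `A` as an operator on the Hilbert space `ℂ²`. -/
def matrixUnitBall : Set (Matrix (Fin 2) (Fin 2) ℂ) :=
  {A | ‖Matrix.toEuclideanCLM (n := Fin 2) (𝕜 := ℂ) A‖ < 1}

/-- The map `A ↦ (a₂₁, tr A, det A)`. Matrix indices start at `0`, so `a₂₁` is `A 1 0`. -/
def pentablockMap (A : Matrix (Fin 2) (Fin 2) ℂ) : Fin 3 → ℂ :=
  ![A 1 0, A.trace, A.det]

/-- The pentablock. -/
def pentablock : Set (Fin 3 → ℂ) :=
  pentablockMap '' matrixUnitBall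

/-! Write a point as (a, s, p), with q(z) = 1 - s z + p z². It lies in the pentablock iff the roots
of X² - s X + p lie in the open disc and |a| (1 - |z|²) < |q(z)| whenever |z| < 1. Necessity is a
Möbius transform of a contraction (`norm_mul_lt_of_mem_pentablock`). For sufficiency the single
value z = conj w is enough, w being the hyperbolic midpoint of the roots: moving w to 0 reduces to
trace-free matrices (`mem_pentablock_of_center`). This also gives openness.

The functions a / q(z) are limits of polynomials on the pentablock, by the geometric series for 1 /
q, so hull points satisfy the non-strict inequalities (`ne_zero_and_norm_mul_le_of_mem_hull`). The
dilation (ra, rs, r²p) with r < 1 makes them strict. A compact subset survives a slight dilation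
with t > 1, so dilating back by 1/t keeps its hull inside; letting r → 1 handles the closure. -/

/-! ### Contractions in coordinates. -/

open ComplexConjugate in
/-- The identity behind the contractivity of Möbius transforms of contractions. -/
theorem normSq_mobius_identity (w x y : ℂ) :
    ‖x + conj w * y‖ ^ 2 - ‖y + w * x‖ ^ 2 = (1 - ‖w‖ ^ 2) * (‖x‖ ^ 2 - ‖y‖ ^ 2) := by
  simp only [← Complex.normSq_eq_norm_sq, Complex.normSq_apply, Complex.add_re, Complex.add_im,
    Complex.mul_re, Complex.mul_im, Complex.conj_re, Complex.conj_im]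
  ring

/-- In finite dimension, a strictly norm-decreasing operator has norm less than one. -/
theorem opNorm_lt_one_of_norm_lt {E : Type*} [NormedAddCommGroup E] [NormedSpace ℂ E]
    [FiniteDimensional ℂ E] (T : E →L[ℂ] E) (h : ∀ v, v ≠ 0 → ‖T v‖ < ‖v‖) : ‖T‖ < 1 := by
  have : ProperSpace E := FiniteDimensional.proper ℂ E
  rcases (Metric.sphere (0 : E) 1).eq_empty_or_nonempty with he | hne
  · refine lt_of_le_of_lt (T.opNorm_le_bound le_rfl fun v => ?_) one_pos
    by_cases hv : v = 0
    · simp [hv]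
    · have : ((‖v‖⁻¹ : ℝ) : ℂ) • v ∈ Metric.sphere (0 : E) 1 := by
        simp [norm_smul, hv]
      simp [he] at this
  · obtain ⟨u, hu, hmax⟩ := (isCompact_sphere (0 : E) 1).exists_isMaxOn hne
      (T.continuous.norm.continuousOn)
    have hu1 : ‖u‖ = 1 := by simpa using hu
    have hu0 : u ≠ 0 := by
      rintro rfl
      simp at hu1
    refine lt_of_le_of_lt (T.opNorm_le_bound (norm_nonneg (T u)) fun v => ?_) (hu1 ▸ h u hu0)
    by_cases hv : v = 0
    · simp [hv]
    · have hv' : ‖v‖ ≠ 0 := norm_ne_zero_iff.2 hv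
      have hs : ((‖v‖⁻¹ : ℝ) : ℂ) • v ∈ Metric.sphere (0 : E) 1 := by
        simp [norm_smul, hv]
      have := hmax hs
      simp only [Set.mem_ofPred_eq, map_smul, norm_smul, Complex.norm_real, norm_inv, norm_norm]
        at this
      rwa [inv_mul_le_iff₀ (by positivity), mul_comm] at this

/-- Membership in the open matrix ball, in coordinates. -/
theorem mem_matrixUnitBall_iff (A : Matrix (Fin 2) (Fin 2) ℂ) :
    A ∈ matrixUnitBall ↔ ∀ v : Fin 2 → ℂ, v ≠ 0 →
      ‖A 0 0 * v 0 + A 0 1 * v 1‖ ^ 2 + ‖A 1 0 * v 0 + A 1 1 * v 1‖ ^ 2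
        < ‖v 0‖ ^ 2 + ‖v 1‖ ^ 2 := by
  have key : ∀ v : EuclideanSpace ℂ (Fin 2),
      ‖Matrix.toEuclideanCLM (n := Fin 2) (𝕜 := ℂ) A v‖ < ‖v‖ ↔
      ‖A 0 0 * v 0 + A 0 1 * v 1‖ ^ 2 + ‖A 1 0 * v 0 + A 1 1 * v 1‖ ^ 2
        < ‖v 0‖ ^ 2 + ‖v 1‖ ^ 2 := by
    intro v
    rw [← sq_lt_sq₀ (norm_nonneg _) (norm_nonneg _), EuclideanSpace.norm_sq_eq,
      EuclideanSpace.norm_sq_eq]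
    simp [Fin.sum_univ_two, Matrix.mulVec, dotProduct]
  constructor
  · intro hA v hv
    have hv' : WithLp.toLp 2 v ≠ (0 : EuclideanSpace ℂ (Fin 2)) := by simpa using hv
    refine (key (WithLp.toLp 2 v)).1 (lt_of_le_of_lt (ContinuousLinearMap.le_opNorm _ _) ?_)
    have h1 : ‖Matrix.toEuclideanCLM (n := Fin 2) (𝕜 := ℂ) A‖ < 1 := hA
    nlinarith [norm_pos_iff.2 hv']
  · intro h
    refine opNorm_lt_one_of_norm_lt _ fun v hv => (key v).2 (h v.ofLp ?_)
    simpa using hv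

theorem mem_pentablock_iff (x : Fin 3 → ℂ) :
    x ∈ pentablock ↔ ∃ A ∈ matrixUnitBall, A 1 0 = x 0 ∧ A 0 0 + A 1 1 = x 1 ∧
      A 0 0 * A 1 1 - A 0 1 * A 1 0 = x 2 := by
  refine exists_congr fun A => and_congr_right fun _ => ?_
  simp [pentablockMap, funext_iff, Fin.forall_fin_succ, Matrix.trace_fin_two, Matrix.det_fin_two]

/-! ### Necessary conditions for membership. -/

/-- A complex quadratic factors. -/
theorem exists_add_eq_mul_eq (s p : ℂ) : ∃ l₁ l₂ : ℂ, l₁ + l₂ = s ∧ l₁ * l₂ = p := by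
  obtain ⟨t, ht⟩ := IsAlgClosed.exists_pow_nat_eq (s ^ 2 - 4 * p) (n := 2) two_pos
  refine ⟨(s + t) / 2, (s - t) / 2, by ring, ?_⟩
  linear_combination (-1 / 4) * ht

theorem norm_lt_one_of_eigenvalue {A : Matrix (Fin 2) (Fin 2) ℂ} (hA : A ∈ matrixUnitBall)
    {l : ℂ} (hl : (A 0 0 - l) * (A 1 1 - l) - A 0 1 * A 1 0 = 0) : ‖l‖ < 1 := by
  have hdet : (A - Matrix.scalar (Fin 2) l).det = 0 := by
    simpa [Matrix.det_fin_two] using hl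
  obtain ⟨v, hv, hv0⟩ := Matrix.exists_mulVec_eq_zero_iff.2 hdet
  have h0 := congrFun hv0 0
  have h1 := congrFun hv0 1
  simp [Matrix.mulVec, dotProduct, Fin.sum_univ_two] at h0 h1
  have e0 : A 0 0 * v 0 + A 0 1 * v 1 = l * v 0 := by linear_combination h0
  have e1 : A 1 0 * v 0 + A 1 1 * v 1 = l * v 1 := by linear_combination h1
  have := (mem_matrixUnitBall_iff A).1 hA v hv
  rw [e0, e1, norm_mul, norm_mul] at this
  by_contra! hge
  have h2 : 1 ≤ ‖l‖ ^ 2 := one_le_pow₀ hge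
  nlinarith [sq_nonneg ‖v 0‖, sq_nonneg ‖v 1‖]

/-- The roots of `X ^ 2 - s X + p` lie in the open unit disc for points of the pentablock. -/
theorem norm_lt_one_of_mem_pentablock {x : Fin 3 → ℂ} (hx : x ∈ pentablock) {l₁ l₂ : ℂ}
    (hs : l₁ + l₂ = x 1) (hp : l₁ * l₂ = x 2) : ‖l₁‖ < 1 ∧ ‖l₂‖ < 1 := by
  obtain ⟨A, hA, -, h1, h2⟩ := (mem_pentablock_iff x).1 hx
  constructor <;> refine norm_lt_one_of_eigenvalue hA ?_
  · linear_combination h2 - l₁ * h1 - hp + l₁ * hs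
  · linear_combination h2 - l₂ * h1 - hp + l₂ * hs

open ComplexConjugate in
theorem norm_mul_lt_of_mem_pentablock {x : Fin 3 → ℂ} (hx : x ∈ pentablock) {z : ℂ}
    (hz : ‖z‖ < 1) : ‖x 0‖ * (1 - ‖z‖ ^ 2) < ‖1 - x 1 * z + x 2 * z ^ 2‖ := by
  obtain ⟨l₁, l₂, hs, hp⟩ := exists_add_eq_mul_eq (x 1) (x 2)
  obtain ⟨n1, n2⟩ := norm_lt_one_of_mem_pentablock hx hs hp
  have hfac : 1 - x 1 * z + x 2 * z ^ 2 = (1 - l₁ * z) * (1 - l₂ * z) := by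
    rw [← hs, ← hp]; ring
  have hne : ∀ l : ℂ, ‖l‖ < 1 → 1 - l * z ≠ 0 := by
    intro l hl h
    have : ‖l * z‖ = 1 := by rw [← sub_eq_zero.1 h]; simp
    rw [norm_mul] at this
    nlinarith [norm_nonneg l, norm_nonneg z]
  have hq : 1 - x 1 * z + x 2 * z ^ 2 ≠ 0 := hfac ▸ mul_ne_zero (hne _ n1) (hne _ n2)
  obtain ⟨A, hA, h0, h1, h2⟩ := (mem_pentablock_iff x).1 hx
  set q := 1 - x 1 * z + x 2 * z ^ 2 with hqdef
  -- `v` is the first column of the adjugate of 1 - zA, so (1 - zA)v = (q, 0), and the second entry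
  -- of (A - conj z)v is a₂₁(1 - |z|²).
  set v : Fin 2 → ℂ := ![1 - z * A 1 1, z * A 1 0] with hv
  have ha : v 0 - z * (A 0 0 * v 0 + A 0 1 * v 1) = q := by
    simp [hv, hqdef, ← h1, ← h2]; ring
  have hb : v 1 - z * (A 1 0 * v 0 + A 1 1 * v 1) = 0 := by
    simp [hv]; ring
  have hc : A 1 0 * v 0 + A 1 1 * v 1 - conj z * v 1 = A 1 0 * (1 - ‖z‖ ^ 2) := by
    simp [hv]; rw [← Complex.conj_mul']; ring
  have hv0 : v ≠ 0 := by
    intro h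
    apply hq
    rw [← ha, h]; simp
  have hlt := (mem_matrixUnitBall_iff A).1 hA v hv0
  have i0 := normSq_mobius_identity (-conj z) (v 0) (A 0 0 * v 0 + A 0 1 * v 1)
  have i1 := normSq_mobius_identity (-conj z) (v 1) (A 1 0 * v 0 + A 1 1 * v 1)
  simp only [map_neg, Complex.conj_conj, neg_mul, ← sub_eq_add_neg, norm_neg,
    RCLike.norm_conj] at i0 i1
  rw [ha] at i0
  rw [hb, hc] at i1
  have hz2 : 0 < 1 - ‖z‖ ^ 2 := by nlinarith [norm_nonneg z]
  have hn : ‖A 1 0 * (1 - (‖z‖ : ℂ) ^ 2)‖ = ‖x 0‖ * (1 - ‖z‖ ^ 2) := by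
    rw [norm_mul, h0]
    congr 1
    rw [← abs_of_pos hz2, ← Real.norm_eq_abs, ← Complex.norm_real]
    simp
  rw [hn, norm_zero] at i1
  refine lt_of_pow_lt_pow_left₀ 2 (norm_nonneg _) ?_
  nlinarith [sq_nonneg ‖A 0 0 * v 0 + A 0 1 * v 1 - conj z * v 0‖, mul_pos hz2 (sub_pos.2 hlt)]

/-! ### Construction of a contraction over a given point. -/

open ComplexConjugate in
/-- A trace-free strict contraction with prescribed determinant and lower left entry. -/
theorem exists_traceless_contraction {m d : ℂ} (hm : ‖m‖ < 1) (hd : ‖d‖ < 1) :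
    ∃ x c : ℂ, x ^ 2 + c * d = m ∧ ∀ v₀ v₁ : ℂ, 0 < ‖v₀‖ ^ 2 + ‖v₁‖ ^ 2 →
      ‖x * v₀ + c * v₁‖ ^ 2 + ‖d * v₀ - x * v₁‖ ^ 2 < ‖v₀‖ ^ 2 + ‖v₁‖ ^ 2 := by
  obtain ⟨μ, rfl⟩ := IsAlgClosed.exists_pow_nat_eq m (n := 2) two_pos
  have hμ : ‖μ‖ ^ 2 < 1 := by simpa using hm
  -- If |d| ≤ |μ|, take μ times a trace-free unitary with lower left entry d/μ; otherwise an
  -- antidiagonal matrix works.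
  rcases le_or_gt ‖d‖ ‖μ‖ with h | h
  · obtain ⟨e, he, rfl⟩ : ∃ e : ℂ, ‖e‖ ≤ 1 ∧ d = μ * e := by
      rcases eq_or_ne μ 0 with rfl | h0
      · exact ⟨0, by simp, by simpa using h⟩
      · refine ⟨d / μ, ?_, by field_simp⟩
        rw [norm_div]
        exact div_le_one_of_le₀ h (norm_nonneg _)
    have hsq : Real.sqrt (1 - ‖e‖ ^ 2) ^ 2 = 1 - ‖e‖ ^ 2 :=
      Real.sq_sqrt (by nlinarith [norm_nonneg e])
    set t := Real.sqrt (1 - ‖e‖ ^ 2)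
    have hsq' : (t : ℂ) ^ 2 = 1 - ‖e‖ ^ 2 := by exact_mod_cast hsq
    refine ⟨μ * t, μ * conj e, ?_, fun v₀ v₁ hv => ?_⟩
    · have := Complex.conj_mul' e
      linear_combination μ ^ 2 * hsq' + μ ^ 2 * this
    · have hu : ‖t * v₀ + conj e * v₁‖ ^ 2 + ‖e * v₀ - t * v₁‖ ^ 2 = ‖v₀‖ ^ 2 + ‖v₁‖ ^ 2 := by
        simp only [← Complex.normSq_eq_norm_sq, Complex.normSq_apply, Complex.add_re,
          Complex.add_im, Complex.sub_re, Complex.sub_im, Complex.ofReal_re, Complex.ofReal_im,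
          Complex.mul_re, Complex.mul_im, Complex.conj_re, Complex.conj_im] at hsq ⊢
        linear_combination (v₀.re * v₀.re + v₀.im * v₀.im + v₁.re * v₁.re + v₁.im * v₁.im) * hsq
      have e1 : μ * t * v₀ + μ * conj e * v₁ = μ * (t * v₀ + conj e * v₁) := by ring
      have e2 : μ * e * v₀ - μ * t * v₁ = μ * (e * v₀ - t * v₁) := by ring
      rw [e1, e2, norm_mul, norm_mul, mul_pow, mul_pow, ← mul_add, hu]
      nlinarith
  · have hd0 : d ≠ 0 := by
      rintro rfl
      simp at h
      linarith [norm_nonneg μ]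
    have hc : ‖μ ^ 2 / d‖ < 1 := by
      rw [norm_div, norm_pow, div_lt_one (norm_pos_iff.2 hd0)]
      nlinarith [norm_nonneg μ]
    refine ⟨0, μ ^ 2 / d, by field_simp; ring, fun v₀ v₁ hv => ?_⟩
    simp only [zero_mul, zero_add, sub_zero, norm_mul, mul_pow]
    have c2 : ‖μ ^ 2 / d‖ ^ 2 < 1 := by nlinarith [norm_nonneg (μ ^ 2 / d)]
    have d2 : ‖d‖ ^ 2 < 1 := by nlinarith [norm_nonneg d]
    rcases (sq_nonneg ‖v₀‖).eq_or_lt with h0 | h0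
    · rw [← h0] at hv ⊢
      nlinarith
    · nlinarith [sq_nonneg ‖v₁‖]

-- The matrix is A = (M + w)(1 + conj w M)⁻¹ with M a trace-free strict contraction. As M² = m is
-- scalar, A = αM + γ. The values of `m` and `d` are forced by det A and a₂₁, `hs` then gives the
-- trace, and `ha` says |d| < 1.
open ComplexConjugate in
theorem mem_pentablock_of_center {x : Fin 3 → ℂ} {w : ℂ} (hw : ‖w‖ < 1) (hp : ‖x 2‖ < 1)
    (hs : (1 + ‖w‖ ^ 2) * x 1 = 2 * (w + conj w * x 2))
    (ha : ‖x 0‖ * (1 + ‖w‖ ^ 2) < ‖1 - conj w ^ 2 * x 2‖) : x ∈ pentablock := by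
  have hWW : conj w * w = (‖w‖ : ℂ) ^ 2 := Complex.conj_mul' w
  have hw2 : ‖w‖ ^ 2 < 1 := by nlinarith [norm_nonneg w]
  have hW1 : (1 : ℂ) + (‖w‖ : ℂ) ^ 2 ≠ 0 := by
    have : (1 : ℝ) + ‖w‖ ^ 2 ≠ 0 := by positivity
    exact_mod_cast this
  have hW2 : (1 : ℂ) - (‖w‖ : ℂ) ^ 2 ≠ 0 := by
    have : (1 : ℝ) - ‖w‖ ^ 2 ≠ 0 := by linarith
    exact_mod_cast this
  set D := 1 - conj w ^ 2 * x 2 with hD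
  have hD0 : D ≠ 0 := norm_pos_iff.1 (lt_of_le_of_lt (by positivity) ha)
  set m := (w ^ 2 - x 2) / D with hmdef
  have hmD : m * D = w ^ 2 - x 2 := div_mul_cancel₀ _ hD0
  have hm : ‖m‖ < 1 := by
    rw [hmdef, norm_div, div_lt_one (norm_pos_iff.2 hD0)]
    have := normSq_mobius_identity (-w ^ 2) 1 (x 2)
    simp only [map_neg, map_pow, neg_mul, norm_neg, norm_pow, norm_one, mul_one,
      ← sub_eq_add_neg] at this
    rw [norm_sub_rev (x 2)] at this
    refine lt_of_pow_lt_pow_left₀ 2 (norm_nonneg _) ?_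
    have h1 : 0 < 1 - (‖w‖ ^ 2) ^ 2 := by nlinarith [sq_nonneg ‖w‖]
    have h2 : 0 < 1 ^ 2 - ‖x 2‖ ^ 2 := by nlinarith [norm_nonneg (x 2)]
    nlinarith [mul_pos h1 h2]
  set d := x 0 * (1 + (‖w‖ : ℂ) ^ 2) / D with hddef
  have hdD : d * D = x 0 * (1 + (‖w‖ : ℂ) ^ 2) := div_mul_cancel₀ _ hD0
  have hd : ‖d‖ < 1 := by
    rw [hddef, norm_div, div_lt_one (norm_pos_iff.2 hD0), norm_mul]
    have : ‖(1 : ℂ) + (‖w‖ : ℂ) ^ 2‖ = 1 + ‖w‖ ^ 2 := by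
      have h := Complex.norm_real (1 + ‖w‖ ^ 2)
      rw [Real.norm_of_nonneg (by positivity)] at h
      exact_mod_cast h
    rwa [this]
  obtain ⟨y, c, hyc, hM⟩ := exists_traceless_contraction hm hd
  set E := 1 - conj w ^ 2 * m with hE
  have hED : E * D = 1 - ((‖w‖ : ℂ) ^ 2) ^ 2 := by
    linear_combination D * hE - conj w ^ 2 * hmD + hD - (conj w * w + (‖w‖ : ℂ) ^ 2) * hWW
  have hE0 : E ≠ 0 := by
    intro h
    rw [h] at hED
    apply mul_ne_zero hW1 hW2
    linear_combination -hED
  set α := (1 - (‖w‖ : ℂ) ^ 2) / E with hα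
  set γ := (w - conj w * m) / E with hγ
  have hαE : α * E = 1 - (‖w‖ : ℂ) ^ 2 := div_mul_cancel₀ _ hE0
  have hγE : γ * E = w - conj w * m := div_mul_cancel₀ _ hE0
  refine (mem_pentablock_iff x).2 ⟨!![α * y + γ, α * c; α * d, -(α * y) + γ], ?_, ?_, ?_, ?_⟩
  · rw [mem_matrixUnitBall_iff]
    intro v hv
    simp only [Matrix.of_apply, Matrix.cons_val_zero, Matrix.cons_val_one, Matrix.cons_val']
    -- u = (1 + conj w M)⁻¹ v, so that Av = (M + w)u and the norm identity applies to u and Mu.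
    set u₀ := (v 0 - conj w * (y * v 0 + c * v 1)) / E with hu₀
    set u₁ := (v 1 - conj w * (d * v 0 - y * v 1)) / E with hu₁
    have k₀ : u₀ * E = v 0 - conj w * (y * v 0 + c * v 1) := div_mul_cancel₀ _ hE0
    have k₁ : u₁ * E = v 1 - conj w * (d * v 0 - y * v 1) := div_mul_cancel₀ _ hE0
    have a₀ : u₀ + conj w * (y * u₀ + c * u₁) = v 0 := by
      apply mul_right_cancel₀ hE0
      linear_combination (1 + conj w * y) * k₀ + conj w * c * k₁ - v 0 * hE
        - conj w ^ 2 * v 0 * hyc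
    have a₁ : u₁ + conj w * (d * u₀ - y * u₁) = v 1 := by
      apply mul_right_cancel₀ hE0
      linear_combination (1 - conj w * y) * k₁ + conj w * d * k₀ - v 1 * hE
        - conj w ^ 2 * v 1 * hyc
    have b₀ : (y * u₀ + c * u₁) + w * u₀ = (α * y + γ) * v 0 + α * c * v 1 := by
      apply mul_right_cancel₀ hE0
      linear_combination (y + w) * k₀ + c * k₁ - (y * v 0 + c * v 1) * hαE - v 0 * hγE
        - conj w * v 0 * hyc - (y * v 0 + c * v 1) * hWW
    have b₁ : (d * u₀ - y * u₁) + w * u₁ = α * d * v 0 + (-(α * y) + γ) * v 1 := by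
      apply mul_right_cancel₀ hE0
      linear_combination (w - y) * k₁ + d * k₀ - (d * v 0 - y * v 1) * hαE - v 1 * hγE
        - conj w * v 1 * hyc - (d * v 0 - y * v 1) * hWW
    have hu : 0 < ‖u₀‖ ^ 2 + ‖u₁‖ ^ 2 := by
      by_contra! hle
      have z₀ : u₀ = 0 := by
        have : ‖u₀‖ ^ 2 = 0 := by nlinarith [sq_nonneg ‖u₀‖, sq_nonneg ‖u₁‖]
        simpa using this
      have z₁ : u₁ = 0 := by
        have : ‖u₁‖ ^ 2 = 0 := by nlinarith [sq_nonneg ‖u₀‖, sq_nonneg ‖u₁‖]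
        simpa using this
      apply hv
      funext i
      fin_cases i
      · simp [← a₀, z₀, z₁]
      · simp [← a₁, z₀, z₁]
    have i₀ := normSq_mobius_identity w u₀ (y * u₀ + c * u₁)
    have i₁ := normSq_mobius_identity w u₁ (d * u₀ - y * u₁)
    rw [a₀, b₀] at i₀
    rw [a₁, b₁] at i₁
    nlinarith [mul_pos (sub_pos.2 hw2) (sub_pos.2 (hM u₀ u₁ hu))]
  · simp only [Matrix.of_apply, Matrix.cons_val_zero, Matrix.cons_val_one, Matrix.cons_val']
    apply mul_right_cancel₀ (mul_ne_zero (mul_ne_zero hE0 hD0) hW1)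
    linear_combination d * D * (1 + (‖w‖ : ℂ) ^ 2) * hαE + (1 - (‖w‖ : ℂ) ^ 2) *
      (1 + (‖w‖ : ℂ) ^ 2) * hdD - x 0 * (1 + (‖w‖ : ℂ) ^ 2) * hED
  · simp only [Matrix.of_apply, Matrix.cons_val_zero, Matrix.cons_val_one, Matrix.cons_val']
    have h : 2 * (w - conj w * m) * D = 2 * (1 - (‖w‖ : ℂ) ^ 2) * (w + conj w * x 2) := by
      linear_combination -2 * conj w * hmD + 2 * w * hD - 2 * (w + conj w * x 2) * hWW
    apply mul_right_cancel₀ (mul_ne_zero (mul_ne_zero hE0 hD0) hW1)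
    linear_combination (1 + (‖w‖ : ℂ) ^ 2) * (2 * D * hγE + h - x 1 * hED)
      - (1 + (‖w‖ : ℂ) ^ 2) * (1 - (‖w‖ : ℂ) ^ 2) * hs
  · simp only [Matrix.of_apply, Matrix.cons_val_zero, Matrix.cons_val_one, Matrix.cons_val']
    have h1 : ((w - conj w * m) ^ 2 - (1 - (‖w‖ : ℂ) ^ 2) ^ 2 * m) = (w ^ 2 - m) * E := by
      rw [← hWW]; ring
    have h2 : (w ^ 2 - m) = x 2 * E := by
      apply mul_right_cancel₀ hD0
      linear_combination -hmD + w ^ 2 * hD + x 2 * conj w ^ 2 * hmD - x 2 * D * hE - x 2 * hD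
    apply mul_right_cancel₀ (mul_ne_zero hE0 hE0)
    linear_combination h1 + E * h2 - E ^ 2 * α ^ 2 * hyc
      - m * (α * E + (1 - (‖w‖ : ℂ) ^ 2)) * hαE + (γ * E + (w - conj w * m)) * hγE

/-! ### The midpoint of the roots and a pointwise criterion. -/

open ComplexConjugate in
/-- The parameter `β` with `s = β + conj β * p`. -/
noncomputable def symmParam (s p : ℂ) : ℂ := (s - conj s * p) / ((1 - ‖p‖ ^ 2 : ℝ) : ℂ)

/-- The hyperbolic midpoint of the roots of `X ^ 2 - s X + p`, when these lie in the unit disc. -/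
noncomputable def rootMidpoint (s p : ℂ) : ℂ :=
  symmParam s p / ((1 + √(1 - ‖symmParam s p‖ ^ 2) : ℝ) : ℂ)

-- With s = β + conj β p, the midpoint w is the solution of 2w = (1 + |w|²)β in the disc.
open ComplexConjugate in
theorem rootMidpoint_spec {s p : ℂ} (hp : ‖p‖ < 1) (hs : ‖s - conj s * p‖ < 1 - ‖p‖ ^ 2) :
    ‖rootMidpoint s p‖ < 1 ∧ (1 + ‖rootMidpoint s p‖ ^ 2) * s =
      2 * (rootMidpoint s p + conj (rootMidpoint s p) * p) := by
  have hp2 : 0 < 1 - ‖p‖ ^ 2 := by nlinarith [norm_nonneg p]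
  have hb : ‖symmParam s p‖ < 1 := by
    rw [symmParam, norm_div, Complex.norm_real, Real.norm_of_nonneg hp2.le, div_lt_one hp2]
    exact hs
  have hβ : s = symmParam s p + conj (symmParam s p) * p := by
    have h0 : ((1 - ‖p‖ ^ 2 : ℝ) : ℂ) ≠ 0 := by exact_mod_cast hp2.ne'
    have h1 := Complex.mul_conj' p
    apply mul_right_cancel₀ h0
    rw [add_mul, symmParam, div_mul_cancel₀ _ h0, map_div₀, Complex.conj_ofReal,
      mul_right_comm, div_mul_cancel₀ _ h0]
    simp only [map_sub, map_mul, Complex.conj_conj]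
    push_cast
    linear_combination s * h1
  set β := symmParam s p
  have hb2 : 0 < 1 - ‖β‖ ^ 2 := by nlinarith [norm_nonneg β]
  have ht := Real.sqrt_pos.2 hb2
  have htsq := Real.sq_sqrt hb2.le
  have hw : rootMidpoint s p = β / ((1 + √(1 - ‖β‖ ^ 2) : ℝ) : ℂ) := rfl
  set t := √(1 - ‖β‖ ^ 2)
  have h1t : 0 < 1 + t := by linarith
  have hnorm : ‖rootMidpoint s p‖ = ‖β‖ / (1 + t) := by
    rw [hw, norm_div, Complex.norm_real, Real.norm_of_nonneg h1t.le]
  have hmul : β = (1 + t : ℝ) * rootMidpoint s p := by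
    rw [hw, mul_div_cancel₀]
    exact_mod_cast h1t.ne'
  have hW : (1 + ‖rootMidpoint s p‖ ^ 2) * (1 + t) = 2 := by
    rw [hnorm]
    field_simp
    linear_combination htsq
  have hWc : (1 + (‖rootMidpoint s p‖ : ℂ) ^ 2) * ((1 + t : ℝ) : ℂ) = 2 := by exact_mod_cast hW
  constructor
  · rw [hnorm, div_lt_one h1t]
    linarith
  · set w := rootMidpoint s p
    rw [hβ, hmul, map_mul, Complex.conj_ofReal]
    linear_combination (w + conj w * p) * hWc

open ComplexConjugate in
/-- An open condition characterizing membership in the pentablock. -/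
def PentablockInequalities (x : Fin 3 → ℂ) : Prop :=
  ‖x 2‖ < 1 ∧ ‖x 1 - conj (x 1) * x 2‖ < 1 - ‖x 2‖ ^ 2 ∧
    ‖x 0‖ * (1 + ‖rootMidpoint (x 1) (x 2)‖ ^ 2) <
      ‖1 - conj (rootMidpoint (x 1) (x 2)) ^ 2 * x 2‖

theorem PentablockInequalities.mem_pentablock {x : Fin 3 → ℂ} (h : PentablockInequalities x) :
    x ∈ pentablock :=
  have hw := rootMidpoint_spec h.1 h.2.1
  mem_pentablock_of_center hw.1 h.1 hw.2 h.2.2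

open ComplexConjugate in
theorem pentablockInequalities_of_roots {x : Fin 3 → ℂ} {l₁ l₂ : ℂ} (h₁ : ‖l₁‖ < 1)
    (h₂ : ‖l₂‖ < 1) (hs : l₁ + l₂ = x 1) (hp : l₁ * l₂ = x 2)
    (hz : ∀ z : ℂ, ‖z‖ < 1 → ‖x 0‖ * (1 - ‖z‖ ^ 2) < ‖1 - x 1 * z + x 2 * z ^ 2‖) :
    PentablockInequalities x := by
  have hp1 : ‖x 2‖ < 1 := by
    rw [← hp, norm_mul]
    nlinarith [norm_nonneg l₁, norm_nonneg l₂]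
  have hs1 : ‖x 1 - conj (x 1) * x 2‖ < 1 - ‖x 2‖ ^ 2 := by
    have e : x 1 - conj (x 1) * x 2 =
        l₁ * ((1 - ‖l₂‖ ^ 2 : ℝ) : ℂ) + l₂ * ((1 - ‖l₁‖ ^ 2 : ℝ) : ℂ) := by
      have c₁ := Complex.conj_mul' l₁
      have c₂ := Complex.conj_mul' l₂
      rw [← hs, ← hp, map_add]
      push_cast
      linear_combination -l₂ * c₁ - l₁ * c₂
    have g₁ : 0 < 1 - ‖l₁‖ ^ 2 := by nlinarith [norm_nonneg l₁]
    have g₂ : 0 < 1 - ‖l₂‖ ^ 2 := by nlinarith [norm_nonneg l₂]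
    have := norm_add_le (l₁ * ((1 - ‖l₂‖ ^ 2 : ℝ) : ℂ)) (l₂ * ((1 - ‖l₁‖ ^ 2 : ℝ) : ℂ))
    rw [← e, norm_mul, norm_mul, Complex.norm_real, Complex.norm_real,
      Real.norm_of_nonneg g₁.le, Real.norm_of_nonneg g₂.le] at this
    rw [← hp, norm_mul] at hp1 ⊢
    rw [hp]
    -- The gap between the two sides is (1 - |l₁|)(1 - |l₂|)(1 - |l₁l₂|).
    nlinarith [mul_pos (mul_pos (sub_pos.2 h₁) (sub_pos.2 h₂)) (sub_pos.2 hp1)]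
  refine ⟨hp1, hs1, ?_⟩
  obtain ⟨hw1, hw⟩ := rootMidpoint_spec hp1 hs1
  set w := rootMidpoint (x 1) (x 2)
  have hW := Complex.conj_mul' w
  -- Only z = conj w is needed from the whole family of inequalities.
  have hlt := hz (conj w) (by simpa using hw1)
  have e : ((1 + ‖w‖ ^ 2 : ℝ) : ℂ) * (1 - x 1 * conj w + x 2 * conj w ^ 2) =
      ((1 - ‖w‖ ^ 2 : ℝ) : ℂ) * (1 - conj w ^ 2 * x 2) := by
    push_cast
    linear_combination -conj w * hw - 2 * hW
  have hw2 : 0 < 1 - ‖w‖ ^ 2 := by nlinarith [norm_nonneg w]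
  have e' := congrArg norm e
  rw [norm_mul, norm_mul, Complex.norm_real, Complex.norm_real, Real.norm_of_nonneg hw2.le,
    Real.norm_of_nonneg (by positivity)] at e'
  rw [RCLike.norm_conj] at hlt
  refine lt_of_mul_lt_mul_left ?_ hw2.le
  rw [← e']
  nlinarith [sq_nonneg ‖w‖]

theorem mem_pentablock_iff_pentablockInequalities {x : Fin 3 → ℂ} :
    x ∈ pentablock ↔ PentablockInequalities x := by
  refine ⟨fun hx => ?_, PentablockInequalities.mem_pentablock⟩
  obtain ⟨l₁, l₂, hs, hp⟩ := exists_add_eq_mul_eq (x 1) (x 2)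
  obtain ⟨h₁, h₂⟩ := norm_lt_one_of_mem_pentablock hx hs hp
  exact pentablockInequalities_of_roots h₁ h₂ hs hp fun z => norm_mul_lt_of_mem_pentablock hx

/-! ### Openness and connectedness. -/

open ComplexConjugate in
theorem isOpen_pentablock : IsOpen pentablock := by
  have hc : ∀ i, Continuous fun x : Fin 3 → ℂ => x i := fun i => continuous_apply i
  rw [isOpen_iff_mem_nhds]
  intro x hx
  obtain ⟨h1, h2, h3⟩ := mem_pentablock_iff_pentablockInequalities.1 hx
  have hβ : ContinuousAt (fun y : Fin 3 → ℂ => symmParam (y 1) (y 2)) x := by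
    unfold symmParam
    refine ContinuousAt.div ?_ ?_ ?_
    · exact ((hc 1).sub ((Complex.continuous_conj.comp (hc 1)).mul (hc 2))).continuousAt
    · exact (Complex.continuous_ofReal.comp
        (continuous_const.sub ((hc 2).norm.pow 2))).continuousAt
    · have : (1 : ℝ) - ‖x 2‖ ^ 2 ≠ 0 := by nlinarith [norm_nonneg (x 2)]
      exact_mod_cast this
  have hw : ContinuousAt (fun y : Fin 3 → ℂ => rootMidpoint (y 1) (y 2)) x := by
    unfold rootMidpoint
    refine ContinuousAt.div hβ ?_ ?_
    · exact Complex.continuous_ofReal.continuousAt.comp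
        (continuousAt_const.add (continuousAt_const.sub (hβ.norm.pow 2)).sqrt)
    · have : (1 : ℝ) + √(1 - ‖symmParam (x 1) (x 2)‖ ^ 2) ≠ 0 := by positivity
      exact_mod_cast this
  have e1 : ∀ᶠ y in nhds x, ‖y 2‖ < 1 :=
    ((hc 2).norm.continuousAt).eventually_lt continuousAt_const h1
  have e2 : ∀ᶠ y : Fin 3 → ℂ in nhds x, ‖y 1 - conj (y 1) * y 2‖ < 1 - ‖y 2‖ ^ 2 := by
    refine ContinuousAt.eventually_lt (f := fun y : Fin 3 → ℂ => ‖y 1 - conj (y 1) * y 2‖)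
      (g := fun y : Fin 3 → ℂ => 1 - ‖y 2‖ ^ 2) ?_ ?_ h2
    · exact Continuous.continuousAt
        (((hc 1).sub ((Complex.continuous_conj.comp (hc 1)).mul (hc 2))).norm)
    · exact (continuous_const.sub ((hc 2).norm.pow 2)).continuousAt
  have e3 : ∀ᶠ y : Fin 3 → ℂ in nhds x, ‖y 0‖ * (1 + ‖rootMidpoint (y 1) (y 2)‖ ^ 2) <
      ‖1 - conj (rootMidpoint (y 1) (y 2)) ^ 2 * y 2‖ := by
    refine ContinuousAt.eventually_lt
      (f := fun y : Fin 3 → ℂ => ‖y 0‖ * (1 + ‖rootMidpoint (y 1) (y 2)‖ ^ 2))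
      (g := fun y : Fin 3 → ℂ => ‖1 - conj (rootMidpoint (y 1) (y 2)) ^ 2 * y 2‖) ?_ ?_ h3
    · exact ((hc 0).norm.continuousAt).mul (continuousAt_const.add (hw.norm.pow 2))
    · exact (continuousAt_const.sub (((Complex.continuous_conj.continuousAt.comp hw).pow 2).mul
        (hc 2).continuousAt)).norm
  filter_upwards [e1, e2, e3] with y k1 k2 k3
  exact PentablockInequalities.mem_pentablock ⟨k1, k2, k3⟩

theorem isConnected_pentablock : IsConnected pentablock := by
  have hcont : Continuous pentablockMap := by
    unfold pentablockMap
    refine continuous_pi fun i => ?_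
    fin_cases i
    · exact continuous_id.matrix_elem 1 0
    · exact continuous_id.matrix_trace
    · exact continuous_id.matrix_det
  refine IsConnected.image ?_ _ hcont.continuousOn
  have h0 : (0 : Matrix (Fin 2) (Fin 2) ℂ) ∈ matrixUnitBall := by simp [matrixUnitBall]
  refine ⟨⟨0, h0⟩, (Convex.isPreconnected (E := Matrix (Fin 2) (Fin 2) ℂ) ?_)⟩
  have : matrixUnitBall = ((Matrix.toEuclideanCLM
      (n := Fin 2) (𝕜 := ℂ)).toAlgEquiv.toLinearMap.restrictScalars ℝ) ⁻¹' (Metric.ball 0 1) := by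
    ext A
    simp [matrixUnitBall]
  rw [this]
  exact (convex_ball _ _).linear_preimage _

/-! ### Polynomial approximation of 1 / q and bounds on the hull. -/

/-- The complete homogeneous symmetric polynomials in two variables, expressed through the
elementary ones `s` and `p`. -/
def completeHomogeneous {R : Type*} [CommRing R] (s p : R) : ℕ → R
  | 0 => 1
  | 1 => s
  | n + 2 => s * completeHomogeneous s p (n + 1) - p * completeHomogeneous s p n

theorem map_completeHomogeneous {R S : Type*} [CommRing R] [CommRing S] (φ : R →+* S) (s p : R) :
    ∀ n, φ (completeHomogeneous s p n) = completeHomogeneous (φ s) (φ p) n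
  | 0 => by simp [completeHomogeneous]
  | 1 => by simp [completeHomogeneous]
  | n + 2 => by
    simp [completeHomogeneous, map_completeHomogeneous φ s p (n + 1),
      map_completeHomogeneous φ s p n]

theorem completeHomogeneous_succ {R : Type*} [CommRing R] (a b : R) (n : ℕ) :
    completeHomogeneous (a + b) (a * b) (n + 1) =
      a * completeHomogeneous (a + b) (a * b) n + b ^ (n + 1) := by
  induction n with
  | zero => simp [completeHomogeneous]
  | succ n ih => rw [completeHomogeneous, ih]; ring

/-- The polynomial is a sum of n + 1 monomials, each bounded by 1. -/
theorem norm_completeHomogeneous_le {a b : ℂ} (ha : ‖a‖ ≤ 1) (hb : ‖b‖ ≤ 1) (n : ℕ) :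
    ‖completeHomogeneous (a + b) (a * b) n‖ ≤ n + 1 := by
  induction n with
  | zero => simp [completeHomogeneous]
  | succ n ih =>
    rw [completeHomogeneous_succ]
    refine (norm_add_le _ _).trans ?_
    rw [norm_mul, norm_pow]
    push_cast
    have := pow_le_one₀ (n := n + 1) (norm_nonneg b) hb
    nlinarith [norm_nonneg (completeHomogeneous (a + b) (a * b) n), norm_nonneg a]

/-- The truncated generating series inverts `1 - s z + p z ^ 2` up to an explicit remainder. -/
theorem mul_sum_completeHomogeneous {R : Type*} [CommRing R] (s p z : R) (N : ℕ) :
    (1 - s * z + p * z ^ 2) * ∑ n ∈ Finset.range (N + 1), completeHomogeneous s p n * z ^ n =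
      1 - completeHomogeneous s p (N + 1) * z ^ (N + 1)
        + p * completeHomogeneous s p N * z ^ (N + 2) := by
  induction N with
  | zero => simp [completeHomogeneous]
  | succ N ih =>
    rw [Finset.sum_range_succ, mul_add, ih, completeHomogeneous]
    ring

theorem norm_mul_sum_completeHomogeneous_sub_one_le {s p z : ℂ} (hp : ‖p‖ ≤ 1)
    (hh : ∀ n, ‖completeHomogeneous s p n‖ ≤ n + 1) (N : ℕ) :
    ‖(1 - s * z + p * z ^ 2) * ∑ n ∈ Finset.range (N + 1), completeHomogeneous s p n * z ^ n - 1‖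
      ≤ (N + 2) * ‖z‖ ^ (N + 1) + (N + 2) * ‖z‖ ^ (N + 1) * ‖z‖ := by
  rw [mul_sum_completeHomogeneous]
  have e : 1 - completeHomogeneous s p (N + 1) * z ^ (N + 1)
        + p * completeHomogeneous s p N * z ^ (N + 2) - 1 =
      p * completeHomogeneous s p N * z ^ (N + 2)
        - completeHomogeneous s p (N + 1) * z ^ (N + 1) := by ring
  rw [e]
  refine (norm_sub_le _ _).trans ?_
  simp only [norm_mul, norm_pow]
  rw [add_comm]
  have h1 := hh (N + 1)
  have h2 := hh N
  push_cast at h1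
  have h3 : ‖p‖ * ‖completeHomogeneous s p N‖ ≤ N + 2 := by
    nlinarith [norm_nonneg (completeHomogeneous s p N), norm_nonneg p]
  refine add_le_add ?_ ?_
  · refine mul_le_mul_of_nonneg_right (by linarith) (by positivity)
  · rw [pow_succ ‖z‖ (N + 1), ← mul_assoc]
    gcongr

theorem tendsto_remainder {r : ℝ} (h0 : 0 ≤ r) (h1 : r < 1) :
    Filter.Tendsto (fun N : ℕ => (N + 2 : ℝ) * r ^ (N + 1) + (N + 2) * r ^ (N + 1) * r)
      Filter.atTop (nhds 0) := by
  have a := (Filter.tendsto_add_atTop_iff_nat 1).2 (tendsto_self_mul_const_pow_of_lt_one h0 h1)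
  have b := (Filter.tendsto_add_atTop_iff_nat 1).2 (tendsto_pow_atTop_nhds_zero_of_lt_one h0 h1)
  have c := a.add b
  have d := c.add (c.mul_const r)
  simp only [add_zero, zero_mul] at d
  refine d.congr fun N => ?_
  push_cast
  ring

open MvPolynomial in
/-- Bounds at points of the polynomial hull of the pentablock. -/
theorem norm_bounds_of_mem_hull {x : Fin 3 → ℂ} (hx : x ∈ polynomialHull pentablock) :
    ‖x 2‖ ≤ 1 ∧ ∀ n, ‖completeHomogeneous (x 1) (x 2) n‖ ≤ n + 1 := by
  have key : ∀ y ∈ pentablock,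
      ‖y 2‖ ≤ 1 ∧ ∀ n, ‖completeHomogeneous (y 1) (y 2) n‖ ≤ n + 1 := by
    intro y hy
    obtain ⟨l₁, l₂, hs, hp⟩ := exists_add_eq_mul_eq (y 1) (y 2)
    obtain ⟨h₁, h₂⟩ := norm_lt_one_of_mem_pentablock hy hs hp
    refine ⟨?_, fun n => ?_⟩
    · rw [← hp, norm_mul]
      nlinarith [norm_nonneg l₁, norm_nonneg l₂]
    · rw [← hs, ← hp]
      exact norm_completeHomogeneous_le h₁.le h₂.le n
  refine ⟨?_, fun n => ?_⟩
  · have := hx (X 2) 1 fun w hw => by simpa using (key w hw).1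
    simpa using this
  · have := hx (completeHomogeneous (X 1) (X 2) n) (n + 1) fun w hw => by
      rw [map_completeHomogeneous, eval_X, eval_X]
      exact (key w hw).2 n
    rwa [map_completeHomogeneous, eval_X, eval_X] at this

open MvPolynomial in
theorem ne_zero_and_norm_mul_le_of_mem_hull {x : Fin 3 → ℂ}
    (hx : x ∈ polynomialHull pentablock) {z : ℂ} (hz : ‖z‖ < 1) :
    1 - x 1 * z + x 2 * z ^ 2 ≠ 0 ∧
      ‖x 0‖ * (1 - ‖z‖ ^ 2) ≤ ‖1 - x 1 * z + x 2 * z ^ 2‖ := by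
  obtain ⟨hp, hh⟩ := norm_bounds_of_mem_hull hx
  have hlim := tendsto_remainder (norm_nonneg z) hz
  have hz2 : 0 < 1 - ‖z‖ ^ 2 := by nlinarith [norm_nonneg z]
  set ε : ℕ → ℝ := fun N => (N + 2 : ℝ) * ‖z‖ ^ (N + 1) + (N + 2) * ‖z‖ ^ (N + 1) * ‖z‖ with hε
  have hrem : ∀ N, ‖(1 - x 1 * z + x 2 * z ^ 2) *
      ∑ n ∈ Finset.range (N + 1), completeHomogeneous (x 1) (x 2) n * z ^ n - 1‖ ≤ ε N :=
    norm_mul_sum_completeHomogeneous_sub_one_le hp hh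
  constructor
  -- At a zero of q the remainder would have norm 1 for every N.
  · intro h0
    have : (1 : ℝ) ≤ 0 := ge_of_tendsto' hlim fun N => by
      have := hrem N
      rw [h0] at this
      simpa using this
    linarith
  · have hbound : ∀ N, ‖x 0 * ∑ n ∈ Finset.range (N + 1),
        completeHomogeneous (x 1) (x 2) n * z ^ n‖ ≤ (1 + ε N) / (1 - ‖z‖ ^ 2) := by
      intro N
      have := hx (X 0 * ∑ n ∈ Finset.range (N + 1),
        completeHomogeneous (X 1) (X 2) n * C z ^ n) ((1 + ε N) / (1 - ‖z‖ ^ 2)) fun y hy => by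
          -- The remainder bound `ε N` depends on z and N alone, so it is uniform over the
          -- pentablock.
          obtain ⟨yp, yh⟩ := norm_bounds_of_mem_hull (x := y) fun f M hM => hM y hy
          have h1 := norm_mul_sum_completeHomogeneous_sub_one_le (z := z) yp yh N
          have h2 := norm_mul_lt_of_mem_pentablock hy hz
          simp only [map_mul, map_sum, map_pow, map_completeHomogeneous, eval_X, eval_C]
          rw [le_div_iff₀ hz2]
          set S := ∑ n ∈ Finset.range (N + 1), completeHomogeneous (y 1) (y 2) n * z ^ n
          have h3 := norm_le_norm_add_norm_sub' ((1 - y 1 * z + y 2 * z ^ 2) * S) 1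
          rw [norm_one, norm_mul] at h3
          rw [norm_mul]
          nlinarith [norm_nonneg S]
      simpa only [map_mul, map_sum, map_pow, map_completeHomogeneous, eval_X, eval_C] using this
    have hineq : ∀ N, ‖x 0‖ * (1 - ‖z‖ ^ 2) * (1 - ε N) ≤
        ‖1 - x 1 * z + x 2 * z ^ 2‖ * (1 + ε N) := by
      intro N
      have h1 := hrem N
      have h2 := hbound N
      set S := ∑ n ∈ Finset.range (N + 1), completeHomogeneous (x 1) (x 2) n * z ^ n
      rw [le_div_iff₀ hz2, norm_mul] at h2
      have h3 := norm_le_norm_add_norm_sub ((1 - x 1 * z + x 2 * z ^ 2) * S) 1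
      rw [norm_one, norm_mul] at h3
      have h4 := mul_le_mul_of_nonneg_left h2 (norm_nonneg (1 - x 1 * z + x 2 * z ^ 2))
      have h5 : 1 - ε N ≤ ‖1 - x 1 * z + x 2 * z ^ 2‖ * ‖S‖ := by linarith
      have h6 := mul_le_mul_of_nonneg_left h5 (mul_nonneg (norm_nonneg (x 0)) hz2.le)
      linarith
    have hl : Filter.Tendsto (fun N => ‖x 0‖ * (1 - ‖z‖ ^ 2) * (1 - ε N)) Filter.atTop
        (nhds (‖x 0‖ * (1 - ‖z‖ ^ 2) * (1 - 0))) := (hlim.const_sub 1).const_mul _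
    have hr : Filter.Tendsto (fun N => ‖1 - x 1 * z + x 2 * z ^ 2‖ * (1 + ε N)) Filter.atTop
        (nhds (‖1 - x 1 * z + x 2 * z ^ 2‖ * (1 + 0))) := (hlim.const_add 1).const_mul _
    simpa using le_of_tendsto_of_tendsto' hl hr hineq

/-! ### Dilations and polynomial convexity. -/

/-- The weighted dilation under which the pentablock is quasi-homogeneous. -/
def pentablockDilation (t : ℝ) (x : Fin 3 → ℂ) : Fin 3 → ℂ :=
  ![t * x 0, t * x 1, t ^ 2 * x 2]

theorem continuous_pentablockDilation :
    Continuous fun q : ℝ × (Fin 3 → ℂ) => pentablockDilation q.1 q.2 := by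
  have hc : ∀ i, Continuous fun q : ℝ × (Fin 3 → ℂ) => q.2 i :=
    fun i => (continuous_apply i).comp continuous_snd
  have ht : Continuous fun q : ℝ × (Fin 3 → ℂ) => (q.1 : ℂ) :=
    Complex.continuous_ofReal.comp continuous_fst
  refine continuous_pi fun i => ?_
  fin_cases i
  · exact ht.mul (hc 0)
  · exact ht.mul (hc 1)
  · exact (ht.pow 2).mul (hc 2)

theorem pentablockDilation_one (x : Fin 3 → ℂ) : pentablockDilation 1 x = x := by
  funext i
  fin_cases i <;> simp [pentablockDilation]

theorem pentablockDilation_inv {t : ℝ} (ht : t ≠ 0) (x : Fin 3 → ℂ) :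
    pentablockDilation t⁻¹ (pentablockDilation t x) = x := by
  funext i
  fin_cases i <;> simp [pentablockDilation, ht]

/-- Proper dilates of hull points lie in the pentablock. -/
theorem pentablockDilation_mem_of_mem_hull {x : Fin 3 → ℂ}
    (hx : x ∈ polynomialHull pentablock) {r : ℝ} (hr0 : 0 < r) (hr1 : r < 1) :
    pentablockDilation r x ∈ pentablock := by
  obtain ⟨l₁, l₂, hs, hp⟩ := exists_add_eq_mul_eq (x 1) (x 2)
  have hroot : ∀ l : ℂ, l ^ 2 - x 1 * l + x 2 = 0 → ‖(r : ℂ) * l‖ < 1 := by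
    intro l hl
    rw [norm_mul, Complex.norm_real, Real.norm_of_nonneg hr0.le]
    rcases le_or_gt ‖l‖ 1 with h | h
    · nlinarith [norm_nonneg l]
    -- A root outside the closed disc would make its inverse a zero of q in the open disc.
    · have hl0 : l ≠ 0 := by
        rintro rfl
        simp at h
        linarith
      exfalso
      refine (ne_zero_and_norm_mul_le_of_mem_hull hx (z := l⁻¹) ?_).1 ?_
      · rw [norm_inv]
        exact inv_lt_one_of_one_lt₀ h
      · field_simp
        linear_combination hl
  have hr1' : r ^ 2 < 1 := by nlinarith
  refine (pentablockInequalities_of_roots (l₁ := r * l₁) (l₂ := r * l₂)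
    (hroot l₁ (by rw [← hs, ← hp]; ring)) (hroot l₂ (by rw [← hs, ← hp]; ring)) ?_ ?_
    fun z hz => ?_).mem_pentablock
  · simp [pentablockDilation, ← hs, mul_add]
  · simp [pentablockDilation, ← hp]; ring
  · have hrz : ‖(r : ℂ) * z‖ = r * ‖z‖ := by
      rw [norm_mul, Complex.norm_real, Real.norm_of_nonneg hr0.le]
    obtain ⟨h0, h⟩ := ne_zero_and_norm_mul_le_of_mem_hull hx (z := r * z)
      (by rw [hrz]; nlinarith [norm_nonneg z])
    have e : 1 - pentablockDilation r x 1 * z + pentablockDilation r x 2 * z ^ 2 =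
        1 - x 1 * (r * z) + x 2 * (r * z) ^ 2 := by
      simp [pentablockDilation]; ring
    have e0 : ‖pentablockDilation r x 0‖ = r * ‖x 0‖ := by
      simp [pentablockDilation, abs_of_pos hr0]
    rw [e, e0]
    rw [hrz] at h
    -- Strictness comes from q ≠ 0 when a = 0, and otherwise from (1 - r)(1 + r|z|²) > 0.
    rcases eq_or_ne (x 0) 0 with hx0 | hx0
    · rw [hx0]
      simpa using h0
    · refine lt_of_lt_of_le ?_ h
      have h1 : r * (1 - ‖z‖ ^ 2) < 1 - (r * ‖z‖) ^ 2 := by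
        nlinarith [mul_nonneg (mul_nonneg hr0.le (sub_pos.2 hr1).le) (sq_nonneg ‖z‖)]
      nlinarith [norm_pos_iff.2 hx0]

theorem polynomialHull_closure_subset {n : ℕ} (K : Set (Fin n → ℂ)) :
    polynomialHull (closure K) ⊆ polynomialHull K := by
  intro x hx f M hM
  refine hx f M fun w hw => ?_
  exact closure_minimal (t := {w | ‖MvPolynomial.eval w f‖ ≤ M}) hM
    (isClosed_le (MvPolynomial.continuous_eval f).norm continuous_const) hw

theorem subset_polynomialHull {n : ℕ} (K : Set (Fin n → ℂ)) : K ⊆ polynomialHull K :=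
  fun z hz _ _ hM => hM z hz

open MvPolynomial in
theorem pentablockDilation_mem_hull {K : Set (Fin 3 → ℂ)} {t : ℝ}
    (hK : ∀ y ∈ K, pentablockDilation t y ∈ pentablock) {x : Fin 3 → ℂ}
    (hx : x ∈ polynomialHull K) : pentablockDilation t x ∈ polynomialHull pentablock := by
  intro f M hM
  -- Precomposing a polynomial with the dilation gives a polynomial.
  have key : ∀ y, eval y (bind₁ ![C (t : ℂ) * X 0, C (t : ℂ) * X 1, C (t : ℂ) ^ 2 * X 2] f) =
      eval (pentablockDilation t y) f := by
    intro y
    rw [← coe_aeval_eq_eval, ← coe_aeval_eq_eval, RingHom.coe_coe, RingHom.coe_coe, aeval_bind₁]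
    congr 2
    funext i
    fin_cases i <;> simp [pentablockDilation]
  rw [← key]
  exact hx _ M fun w hw => by
    rw [key]
    exact hM _ (hK w hw)

theorem pentablock_hull_subset {K : Set (Fin 3 → ℂ)} (hK : IsCompact K) (hKP : K ⊆ pentablock) :
    polynomialHull K ⊆ pentablock := by
  intro x hx
  have hev : ∀ᶠ t : ℝ in nhds 1, ∀ y ∈ K, pentablockDilation t y ∈ pentablock := by
    refine hK.eventually_forall_of_forall_eventually fun y hy => ?_
    refine continuous_pentablockDilation.continuousAt.eventually_mem
      (isOpen_pentablock.mem_nhds ?_)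
    rw [pentablockDilation_one]
    exact hKP hy
  obtain ⟨t, ht, ht1⟩ := ((hev.filter_mono nhdsWithin_le_nhds).and
    (self_mem_nhdsWithin (s := Set.Ioi (1 : ℝ)))).exists
  have ht0 : (0 : ℝ) < t := one_pos.trans ht1
  rw [← pentablockDilation_inv ht0.ne' x]
  exact pentablockDilation_mem_of_mem_hull (pentablockDilation_mem_hull ht hx) (inv_pos.2 ht0)
    (inv_lt_one_of_one_lt₀ ht1)

theorem isCompact_closure_pentablock : IsCompact (closure pentablock) := by
  refine Bornology.IsBounded.isCompact_closure ?_
  refine (Metric.isBounded_closedBall (x := (0 : Fin 3 → ℂ)) (r := 2)).subset fun x hx => ?_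
  obtain ⟨hp, hh⟩ := norm_bounds_of_mem_hull (subset_polynomialHull _ hx)
  have h0 := norm_mul_lt_of_mem_pentablock hx (z := 0) (by simp)
  -- The first complete homogeneous polynomial is s itself, hence |s| ≤ 2, the radius.
  have h1 := hh 1
  simp [completeHomogeneous] at h0 h1
  rw [mem_closedBall_zero_iff, pi_norm_le_iff_of_nonneg (by norm_num)]
  intro i
  fin_cases i
  · simpa using h0.le.trans one_le_two
  · simp; linarith
  · simpa using hp.trans one_le_two

theorem polynomialHull_closure_pentablock :
    polynomialHull (closure pentablock) = closure pentablock := by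
  refine Set.Subset.antisymm (fun x hx => ?_) (subset_polynomialHull _)
  have hlim : Filter.Tendsto (fun r : ℝ => pentablockDilation r x) (nhdsWithin 1 (Set.Iio 1))
      (nhds x) := by
    have hc : Continuous fun r : ℝ => pentablockDilation r x :=
      continuous_pentablockDilation.comp (Continuous.prodMk continuous_id continuous_const)
    have := hc.tendsto 1
    rw [pentablockDilation_one] at this
    exact this.mono_left nhdsWithin_le_nhds
  refine mem_closure_of_tendsto hlim ?_
  filter_upwards [Ioo_mem_nhdsLT (zero_lt_one' ℝ)] with r hr
  exact pentablockDilation_mem_of_mem_hull (polynomialHull_closure_subset _ hx) hr.1 hr.2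

theorem mainTheorem4 :
    IsPolynomiallyConvexDomain pentablock ∧
      IsPolynomiallyConvexCompact (closure pentablock) := by
  exact ⟨⟨isOpen_pentablock, isConnected_pentablock, fun _ => pentablock_hull_subset⟩,
    ⟨isCompact_closure_pentablock, polynomialHull_closure_pentablock⟩⟩
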